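/- All rings are commutative with identity. An $R$-module is *cyclically presented* if it is isomorphic to $R/aR$ for some $a\in R$. For $x\in R$ put $\mathrm{Ann}(x)=\{a\in R: ax=0\}$. A ring is *semi-local* if it has only finitely many maximal ideals. Direct sums may be infinite, and an empty direct sum is $0$. In every decomposition $M=\bigoplus_{i\in I}Rx_i$ of a maximal ideal into cyclic ideals that occurs below, the sum is internal and all summands $Rx_i$ are understood to be nonzero. Let $R$ be a semi-local ring with $\mathrm{Max}(R)=\{M_1,\dots,M_t\}$. We say that $R$ satisfies condition $(*)$ if the following hold: (a) whenever $M_j=Rx\oplus L$ for some $j$, some $x\in R$ and some ideal $L$ of $R$ such that $R/\mathrm{Ann}(x)$ is a principal ideal ring, every nonzero element of $Rx$ is of the form $ax^n$ with $a\in R$ a unit and $n$ a positive integer (here $x=0$ and $L=0$ are allowed); (b) whenever $M_j=Rx_1\oplus\cdots\oplus Rx_n$ for some $j$, one has $\mathrm{Ann}(x_i^{\alpha})\subseteq M_j$ for every $i\in\{1,\dots,n\}$ and every positive integer $\alpha$; (c) for every finitely generated $R$-module $N$ and every ideal $I$ of $R$ with $I\subseteq M_j$ for some $j$, if $N=IN$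 then $N=0$. **Theorem.** Let $R$ be a semi-local ring satisfying condition $(*)$, with $\mathrm{Max}(R)=\{M_1,\dots,M_t\}$, and assume that whenever $M_j=\bigoplus_{i\in I}Rx_{i}$ for some $j$ (with $I$ an arbitrary index set), no $x_{i}$ is nilpotent. Then the following statements are equivalent: (1) Every ideal of $R$ is a direct sum of cyclically presented $R$-modules. (2) Every ideal of $R$ is (isomorphic to) a direct summand of a direct sum of cyclically presented $R$-modules. (3) Every prime ideal of $R$ is a direct sum of cyclically presented $R$-modules. (4) Every prime ideal of $R$ is (isomorphic to) a direct summand of a direct sum of cyclically presented $R$-modules. (5) Either $R$ is a principal ideal ring, or for every $j\in\{1,\dots,t\}$ there are nonzero $x_{1,j},x_{2,j}\in R$ with $M_j=Rx_{1,j}\oplus Rx_{2,j}$ such that $R/\mathrm{Ann}(x_{1,j})$ and $R/\mathrm{Ann}(x_{2,j})$ are principal ideal rings. -/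

import Mathlib

open scoped DirectSum

universe u

/-- An `R`-module is a direct sum of cyclically presented modules if it is isomorphic to a
(possibly empty or infinite) direct sum of modules of the form `R / aR`. -/
def IsDirectSumOfCyclicallyPresented (R : Type u) [CommRing R] (N : Type u) [AddCommGroup N]
    [Module R N] : Prop :=
  ∃ (ι : Type u) (a : ι → R), Nonempty (N ≃ₗ[R] ⨁ i, (R ⧸ Ideal.span {a i}))

/-- An `R`-module is (isomorphic to) a direct summand of a direct sum of cyclically presented
modules. -/
def IsSummandOfDirectSumOfCyclicallyPresented (R : Type u) [CommRing R] (N : Type u)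
    [AddCommGroup N] [Module R N] : Prop :=
  ∃ (ι : Type u) (a : ι → R) (A B : Submodule R (⨁ i, (R ⧸ Ideal.span {a i}))),
    IsCompl A B ∧ Nonempty (N ≃ₗ[R] A)

/-- `I = ⨁ i, R x_i`, an internal direct sum of nonzero cyclic ideals. The zero ideal has the
empty decomposition only. -/
structure IsCyclicDecomposition {R : Type u} [CommRing R] {ι : Type*} (I : Ideal R)
    (x : ι → R) : Prop where
  ne_zero : ∀ i, x i ≠ 0
  indep : iSupIndep fun i => Ideal.span {x i}
  iSup_eq : ⨆ i, Ideal.span {x i} = I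

/-- Condition `(*)` on a ring `R`. Here `Ideal.torsionOf R R x` is
`Ann(x) = {a | a * x = 0}`. -/
structure ConditionStar (R : Type u) [CommRing R] : Prop where
  /-- If `M = Rx ⊕ L` with `M` maximal and `R / Ann(x)` a principal ideal ring, then every nonzero
  element of `Rx` is a unit times a positive power of `x`. -/
  unit_mul_pow : ∀ (M : Ideal R), M.IsMaximal → ∀ (x : R) (L : Ideal R),
    Disjoint (Ideal.span {x}) L → Ideal.span {x} ⊔ L = M →
    IsPrincipalIdealRing (R ⧸ Ideal.torsionOf R R x) →
    ∀ z ∈ Ideal.span {x}, z ≠ 0 → ∃ (a : R) (n : ℕ), IsUnit a ∧ 0 < n ∧ z = a * x ^ n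
  /-- If `M = Rx₁ ⊕ ⋯ ⊕ Rxₙ` is maximal, then `Ann(xᵢ ^ α) ⊆ M` for all `i` and `α ≥ 1`. -/
  ann_pow_le : ∀ (M : Ideal R), M.IsMaximal → ∀ (n : ℕ) (x : Fin n → R),
    IsCyclicDecomposition M x →
    ∀ (i : Fin n) (α : ℕ), 0 < α → Ideal.torsionOf R R (x i ^ α) ≤ M
  /-- If `N` is a finitely generated module and `N = IN` for an ideal `I` contained in some maximal
  ideal, then `N = 0`. -/
  nakayama : ∀ (N : Type u) [AddCommGroup N] [Module R N], Module.Finite R N →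
    ∀ (M : Ideal R), M.IsMaximal → ∀ I : Ideal R, I ≤ M →
    I • (⊤ : Submodule R N) = ⊤ → Subsingleton N

/-! The Nakayama clause of (*) forces a nonzero ring to be local (`ConditionStar.isLocalRing`), say
with maximal ideal m.

From primes to structure: over a local ring a nonzero retract of a direct sum of cyclically
presented modules splits off some R/aR (`exists_isCompl_span`). Splitting m twice gives m = Rx ⊕ L
and L = Ry ⊕ L'. As xy = 0 and Ann(x) is principal, comparing components gives Ann(x) = Ry; but L
kills x, so L = Ry, and symmetrically Ann(y) = Rx. A prime containing y but not x equals Ry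
(`prime_eq_span_singleton`), so all primes of R/Ry are principal and R/Ry is a principal ideal ring.
If m is zero or a single Rx, the same argument applies to R itself.

From structure to all ideals: with m = Rx ⊕ Ry, elements of Rx and Ry are units times powers. Hence
a proper ideal is zero, one of Rx^n and Ry^m, their direct sum, or R(x^n + u y^m) with u a unit.
Non-nilpotency makes Ann(x^n) = Ry and Ann(y^m) = Rx, and the mixed generator has zero annihilator.
-/

/-- `N` is a retract of a direct sum of cyclically presented modules. -/
def IsRetractOfCyclicallyPresented (R : Type u) [CommRing R] (N : Type u)
    [AddCommGroup N] [Module R N] : Prop :=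
  ∃ (ι : Type u) (a : ι → R) (s : N →ₗ[R] ⨁ i, (R ⧸ Ideal.span {a i}))
    (p : (⨁ i, (R ⧸ Ideal.span {a i})) →ₗ[R] N), ∀ n, p (s n) = n

/-! ### Retracts of direct sums of cyclically presented modules -/

section General

variable {R : Type u} [CommRing R] {N : Type u} [AddCommGroup N] [Module R N]

theorem IsDirectSumOfCyclicallyPresented.isSummand (h : IsDirectSumOfCyclicallyPresented R N) :
    IsSummandOfDirectSumOfCyclicallyPresented R N := by
  obtain ⟨ι, a, ⟨e⟩⟩ := h
  exact ⟨ι, a, ⊤, ⊥, isCompl_top_bot, ⟨e.trans Submodule.topEquiv.symm⟩⟩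

theorem IsSummandOfDirectSumOfCyclicallyPresented.isRetract
    (h : IsSummandOfDirectSumOfCyclicallyPresented R N) :
    IsRetractOfCyclicallyPresented R N := by
  obtain ⟨ι, a, A, B, hAB, ⟨e⟩⟩ := h
  refine ⟨ι, a, A.subtype ∘ₗ e.toLinearMap,
    e.symm.toLinearMap ∘ₗ A.projectionOnto B hAB, fun n => ?_⟩
  simp

theorem IsRetractOfCyclicallyPresented.of_leftInverse {L : Type u} [AddCommGroup L] [Module R L]
    (h : IsRetractOfCyclicallyPresented R N) (s : L →ₗ[R] N) (p : N →ₗ[R] L)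
    (hps : ∀ l, p (s l) = l) : IsRetractOfCyclicallyPresented R L := by
  obtain ⟨ι, a, s', p', h'⟩ := h
  exact ⟨ι, a, s' ∘ₗ s, p ∘ₗ p', fun n => by simp [h', hps]⟩

theorem exists_isUnit_of_not_mem_smul_top [IsLocalRing R] {I : Ideal R} {z : R ⧸ I}
    (hz : z ∉ IsLocalRing.maximalIdeal R • (⊤ : Submodule R (R ⧸ I))) :
    ∃ r : R, IsUnit r ∧ z = Ideal.Quotient.mk I r := by
  obtain ⟨r, rfl⟩ := Ideal.Quotient.mk_surjective z
  refine ⟨r, ?_, rfl⟩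
  by_contra hr
  apply hz
  have : Ideal.Quotient.mk I r = r • (1 : R ⧸ I) := by
    rw [Algebra.smul_def, mul_one]; rfl
  rw [this]
  exact Submodule.smul_mem_smul ((IsLocalRing.mem_maximalIdeal r).2 hr) trivial

theorem pi_mem_smul_top {S : Type*} [Finite S] (J : Ideal R) {C : S → Type*}
    [∀ i, AddCommGroup (C i)] [∀ i, Module R (C i)] (v : ∀ i, C i)
    (hv : ∀ i, v i ∈ J • (⊤ : Submodule R (C i))) :
    v ∈ J • (⊤ : Submodule R (∀ i, C i)) := by
  classical
  cases nonempty_fintype S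
  have hsum : v = ∑ i, LinearMap.single R C i (v i) :=
    (Finset.univ_sum_single v).symm
  rw [hsum]
  refine Submodule.sum_mem _ fun i _ => ?_
  have : LinearMap.single R C i (v i) ∈ (J • (⊤ : Submodule R (C i))).map (LinearMap.single R C i) :=
    Submodule.mem_map_of_mem (hv i)
  rw [Submodule.map_smul''] at this
  exact Submodule.smul_mono le_rfl le_top this

/-- Coordinates on a retract of a direct sum of cyclic modules. -/
theorem IsRetractOfCyclicallyPresented.exists_coordinates
    (h : IsRetractOfCyclicallyPresented R N) :
    ∃ (ι : Type u) (a : ι → R) (f : ∀ i, N →ₗ[R] R ⧸ Ideal.span {a i})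
      (g : ∀ i, (R ⧸ Ideal.span {a i}) →ₗ[R] N), ∀ n, ∃ S : Finset ι,
        n = ∑ i ∈ S, g i (f i n) := by
  classical
  obtain ⟨ι, a, s, p, h⟩ := h
  refine ⟨ι, a, fun i => DirectSum.component R ι _ i ∘ₗ s,
    fun i => p ∘ₗ DirectSum.lof R ι (fun i => R ⧸ Ideal.span {a i}) i, fun n => ⟨DFinsupp.support (s n), ?_⟩⟩
  conv_lhs => rw [← h n, ← DirectSum.sum_support_of (s n), map_sum]
  rfl

/-- Otherwise, for a finite set S carrying n ≠ 0, the matrix of maps f_i ∘ g_j maps into the maximal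
ideal times the product. Then identity minus matrix is surjective by Nakayama, hence injective on a
finitely generated module. It kills the coordinate vector of n, so n = 0. -/
theorem exists_coordinate_not_mem [IsLocalRing R] [Nontrivial N] {ι : Type u} {I : ι → Ideal R}
    (f : ∀ i, N →ₗ[R] R ⧸ I i) (g : ∀ i, (R ⧸ I i) →ₗ[R] N)
    (h : ∀ n, ∃ S : Finset ι, n = ∑ i ∈ S, g i (f i n)) :
    ∃ n i, f i n ∉ IsLocalRing.maximalIdeal R • (⊤ : Submodule R (R ⧸ I i)) := by
  classical
  by_contra! hc
  obtain ⟨n, hn⟩ := exists_ne (0 : N)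
  obtain ⟨S, hS⟩ := h n
  let φ : (∀ i : S, R ⧸ I i) →ₗ[R] (∀ i : S, R ⧸ I i) :=
    LinearMap.pi fun i => f i ∘ₗ ∑ j : S, g j ∘ₗ LinearMap.proj j
  have hφ : LinearMap.range φ ≤ IsLocalRing.maximalIdeal R • ⊤ := by
    rintro _ ⟨v, rfl⟩
    exact pi_mem_smul_top _ _ fun i => hc _ _
  let ψ : Module.End R (∀ i : S, R ⧸ I i) := LinearMap.id - φ
  have hsurj : Function.Surjective ψ := by
    rw [← LinearMap.range_eq_top, ← top_le_iff]
    refine Submodule.le_of_le_smul_of_le_jacobson_bot (R := R) (I := IsLocalRing.maximalIdeal R)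
      Module.Finite.fg_top
      (IsLocalRing.maximalIdeal_le_jacobson _) fun v _ => ?_
    have : v = ψ v + φ v := by simp [ψ]
    rw [this]
    exact Submodule.add_mem_sup ⟨v, rfl⟩ (hφ ⟨v, rfl⟩)
  have hinj := OrzechProperty.injective_of_surjective_endomorphism _ hsurj
  have hv : ψ (fun i : S => f i n) = 0 := by
    ext i
    have : f i (∑ j : S, g j (f j n)) = f i n := by
      rw [Finset.sum_coe_sort S fun j => g j (f j n), ← hS]
    simp only [map_sum, Finset.univ_eq_attach] at this
    simp [ψ, φ, this]
  have hv0 : (fun i : S => f i n) = 0 := hinj (by rw [hv, map_zero])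
  refine hn (hS.trans (Finset.sum_eq_zero fun i hi => ?_))
  have : f i n = 0 := congrFun hv0 ⟨i, hi⟩
  rw [this, map_zero]

/-- A nonzero retract of a direct sum of cyclically presented modules over a local ring has a
nonzero cyclically presented direct summand. -/
theorem IsRetractOfCyclicallyPresented.exists_isCompl_span [IsLocalRing R] [Nontrivial N]
    (h : IsRetractOfCyclicallyPresented R N) :
    ∃ (y : N) (L : Submodule R N) (a : R), y ≠ 0 ∧ IsCompl (R ∙ y) L ∧
      ∀ r : R, r • y = 0 ↔ a ∣ r := by
  classical
  obtain ⟨ι, a, f, g, hfg⟩ := h.exists_coordinates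
  obtain ⟨n, i₀, hi₀⟩ := exists_coordinate_not_mem f g hfg
  obtain ⟨S, hS⟩ := hfg n
  let J := IsLocalRing.maximalIdeal R
  -- transfer: a unit coordinate of `n` comes from a unit coordinate of some `g j 1`
  have key : ∀ i, f i n ∉ J • (⊤ : Submodule R (R ⧸ Ideal.span {a i})) → ∃ j ∈ S,
      f j n ∉ J • (⊤ : Submodule R (R ⧸ Ideal.span {a j})) ∧
      f i (g j 1) ∉ J • (⊤ : Submodule R (R ⧸ Ideal.span {a i})) := by
    intro i hi
    by_contra! hc
    apply hi
    rw [hS, map_sum]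
    refine Submodule.sum_mem _ fun j hj => ?_
    by_cases hj' : f j n ∈ J • (⊤ : Submodule R (R ⧸ Ideal.span {a j}))
    · have := Submodule.mem_map_of_mem (f := f i ∘ₗ g j) hj'
      rw [Submodule.map_smul''] at this
      exact Submodule.smul_mono le_rfl le_top this
    · obtain ⟨r, hr⟩ := Ideal.Quotient.mk_surjective (f j n)
      have hr' : f j n = r • (1 : R ⧸ Ideal.span {a j}) := by
        rw [← hr, Algebra.smul_def, mul_one]; rfl
      rw [hr', map_smul, map_smul]
      exact Submodule.smul_mem _ _ (hc j hj hj')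
  -- The index i₀ may lie outside S; this only supplies a good index inside S.
  obtain ⟨j₀, hj₀S, hj₀, -⟩ := key i₀ hi₀
  -- Choosing R a_i minimal turns the inclusion R a_j ⊆ R a_i found below into an equality, so that
  -- g_j is injective and split by f_i up to a unit.
  obtain ⟨i, hi, hmin⟩ := (S.filter fun i =>
      f i n ∉ J • (⊤ : Submodule R (R ⧸ Ideal.span {a i}))).exists_minimalFor
    (fun i => Ideal.span {a i}) ⟨j₀, Finset.mem_filter.2 ⟨hj₀S, hj₀⟩⟩
  obtain ⟨j, hjS, hj, hji⟩ := key i (Finset.mem_filter.1 hi).2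
  obtain ⟨u, hu, hfu⟩ := exists_isUnit_of_not_mem_smul_top hji
  have hsmul : ∀ r : R, f i (r • g j 1) = 0 ↔ a i ∣ r := by
    intro r
    rw [map_smul, hfu, ← Ideal.mem_span_singleton, ← Ideal.mul_unit_mem_iff_mem _ hu,
      ← Ideal.Quotient.eq_zero_iff_mem, map_mul]
    rfl
  have haj : ∀ r : R, a j ∣ r → r • g j 1 = 0 := by
    intro r hr
    rw [← map_smul, Algebra.smul_def, mul_one]
    have : algebraMap R (R ⧸ Ideal.span {a j}) r = 0 :=
      Ideal.Quotient.eq_zero_iff_mem.2 (Ideal.mem_span_singleton.2 hr)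
    rw [this, map_zero]
  have hle : Ideal.span {a j} ≤ Ideal.span {a i} := by
    rw [Ideal.span_singleton_le_span_singleton, ← hsmul, haj _ dvd_rfl, map_zero]
  have hge : a j ∣ a i := by
    rw [← Ideal.span_singleton_le_span_singleton]
    exact hmin (Finset.mem_filter.2 ⟨hjS, hj⟩) hle
  have hann : ∀ r : R, r • g j 1 = 0 ↔ a i ∣ r := fun r =>
    ⟨fun h => (hsmul r).1 (by rw [h, map_zero]), fun h => haj r (hge.trans h)⟩
  refine ⟨g j 1, LinearMap.ker (f i), a i, ?_, ⟨?_, ?_⟩, hann⟩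
  · intro h0
    rw [h0, map_zero] at hji
    exact hji (zero_mem _)
  · rw [Submodule.disjoint_def]
    intro z hz hz'
    obtain ⟨r, rfl⟩ := Submodule.mem_span_singleton.1 hz
    exact (hann r).2 ((hsmul r).1 hz')
  · rw [codisjoint_iff, eq_top_iff]
    intro z _
    obtain ⟨r, hr⟩ := Ideal.Quotient.mk_surjective (f i z)
    obtain ⟨v, rfl⟩ := hu
    refine Submodule.mem_sup.2 ⟨(r * (v⁻¹ : Rˣ)) • g j 1,
      Submodule.smul_mem _ _ (Submodule.mem_span_singleton_self _),
      z - (r * (v⁻¹ : Rˣ)) • g j 1, ?_, by abel⟩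
    rw [LinearMap.mem_ker, map_sub, map_smul, hfu, ← hr, sub_eq_zero]
    have : (r * (v⁻¹ : Rˣ)) • Ideal.Quotient.mk (Ideal.span {a i}) (v : R) =
        Ideal.Quotient.mk (Ideal.span {a i}) (r * (v⁻¹ : Rˣ) * v) := by
      rw [map_mul _ _ (v : R)]; rfl
    rw [this, Units.inv_mul_cancel_right]

end General

/-! ### Prime ideals and the maximal ideal of a local ring -/

section Local

variable {R : Type u} [CommRing R]

theorem IsRetractOfCyclicallyPresented.of_disjoint_sup {J A L : Ideal R}
    (h : IsRetractOfCyclicallyPresented R J) (hd : Disjoint A L) (hs : A ⊔ L = J) :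
    IsRetractOfCyclicallyPresented R L := by
  subst hs
  have hc : IsCompl (L.submoduleOf (A ⊔ L)) (A.submoduleOf (A ⊔ L)) := by
    constructor
    · rw [Submodule.disjoint_def]
      intro z hz hz'
      exact Subtype.ext (Submodule.disjoint_def.1 hd z hz' hz)
    · rw [codisjoint_iff, eq_top_iff]
      rintro ⟨z, hz⟩ -
      obtain ⟨a, ha, l, hl, rfl⟩ := Submodule.mem_sup.1 hz
      exact Submodule.mem_sup.2 ⟨⟨l, Submodule.mem_sup_right hl⟩, hl,
        ⟨a, Submodule.mem_sup_left ha⟩, ha, Subtype.ext (add_comm l a)⟩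
  have e : L.submoduleOf (A ⊔ L) ≃ₗ[R] L := Submodule.submoduleOfEquivOfLe le_sup_right
  refine h.of_leftInverse ((L.submoduleOf (A ⊔ L)).subtype ∘ₗ e.symm.toLinearMap)
    (e.toLinearMap ∘ₗ (L.submoduleOf (A ⊔ L)).projectionOnto _ hc) fun l => ?_
  simp

theorem IsRetractOfCyclicallyPresented.exists_span_sup [IsLocalRing R] {J : Ideal R}
    (h : IsRetractOfCyclicallyPresented R J) (hJ : J ≠ ⊥) :
    ∃ (y : R) (L : Ideal R) (a : R), y ≠ 0 ∧ Disjoint (Ideal.span {y}) L ∧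
      Ideal.span {y} ⊔ L = J ∧ IsRetractOfCyclicallyPresented R L ∧
      ∀ r : R, r * y = 0 ↔ a ∣ r := by
  have : Nontrivial J := Submodule.nontrivial_iff_ne_bot.2 hJ
  obtain ⟨y, L, a, hy, hc, ha⟩ := h.exists_isCompl_span
  have hspan : (R ∙ y).map J.subtype = Ideal.span {(y : R)} := by
    rw [Submodule.map_span, Set.image_singleton]; rfl
  have hd : Disjoint (Ideal.span {(y : R)}) (L.map J.subtype) := by
    rw [← hspan]
    exact (Submodule.disjoint_map J.injective_subtype hc.disjoint)
  have hs : Ideal.span {(y : R)} ⊔ L.map J.subtype = J := by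
    rw [← hspan, ← Submodule.map_sup, hc.sup_eq_top, Submodule.map_top, Submodule.range_subtype]
  refine ⟨y, L.map J.subtype, a, fun h0 => hy (Subtype.ext h0), hd, hs,
    h.of_disjoint_sup hd hs, fun r => ?_⟩
  rw [← ha, ← Submodule.coe_eq_zero]
  rfl

theorem Disjoint.eq_zero_of_add_eq_zero {A B : Ideal R} (h : Disjoint A B) {a b : R}
    (ha : a ∈ A) (hb : b ∈ B) (hab : a + b = 0) : a = 0 ∧ b = 0 := by
  have h0 : a = 0 := Submodule.disjoint_def.1 h a ha (by
    rw [eq_neg_of_add_eq_zero_left hab]; exact neg_mem hb)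
  exact ⟨h0, by rwa [h0, zero_add] at hab⟩

theorem mul_eq_zero_of_disjoint {A B : Ideal R} (h : Disjoint A B) {a b : R}
    (ha : a ∈ A) (hb : b ∈ B) : a * b = 0 :=
  Submodule.disjoint_def.1 h _ (A.mul_mem_right b ha) (B.mul_mem_left a hb)

theorem mem_span_singleton_sup_span {x y z : R} :
    z ∈ Ideal.span {x} ⊔ Ideal.span {y} ↔ ∃ s t, z = s * x + t * y := by
  rw [← Ideal.span_insert, Ideal.mem_span_pair]
  simp only [eq_comm]

theorem mem_span_singleton_sup {x z : R} {L : Ideal R} :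
    z ∈ Ideal.span {x} ⊔ L ↔ ∃ s, ∃ l ∈ L, z = s * x + l := by
  rw [Ideal.mem_span_singleton_sup]
  simp only [eq_comm]

theorem isCyclicDecomposition_pair {M : Ideal R} {x y : R} (hx : x ≠ 0) (hy : y ≠ 0)
    (hd : Disjoint (Ideal.span {x}) (Ideal.span {y}))
    (hM : Ideal.span {x} ⊔ Ideal.span {y} = M) : IsCyclicDecomposition M ![x, y] := by
  refine ⟨?_, ?_, ?_⟩
  · intro i; fin_cases i
    · exact hx
    · exact hy
  · rw [iSupIndep_pair (i := (0 : Fin 2)) (j := 1) (by decide) (by decide)]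
    exact hd
  · rw [← hM]
    apply le_antisymm
    · refine iSup_le fun i => ?_
      fin_cases i
      · exact le_sup_left
      · exact le_sup_right
    · exact sup_le (le_iSup (fun i => Ideal.span {![x, y] i}) 0)
        (le_iSup (fun i => Ideal.span {![x, y] i}) 1)

theorem torsionOf_eq_span {x y : R} (h : ∀ r : R, r * x = 0 ↔ y ∣ r) :
    Ideal.torsionOf R R x = Ideal.span {y} := by
  ext r
  rw [Ideal.mem_torsionOf_iff, smul_eq_mul, h, Ideal.mem_span_singleton]

variable [IsLocalRing R]

/-- Local substitute for cancellation when comparing coefficients of a nonzero y: were c a nonunit,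
1 - c would be a unit. -/
theorem isUnit_of_one_sub_mul_eq_zero {c y : R} (hy : y ≠ 0) (h : (1 - c) * y = 0) : IsUnit c := by
  rcases IsLocalRing.isUnit_or_isUnit_one_sub_self c with hc | hc
  · exact hc
  · exact absurd ((hc.mul_right_eq_zero).1 h) hy

theorem isUnit_of_mem_add {c d : R} (hd : d ∈ IsLocalRing.maximalIdeal R) (h : IsUnit (d + c)) :
    IsUnit c :=
  (IsLocalRing.isUnit_or_isUnit_of_isUnit_add h).resolve_left hd

/-- If `Ry` is a summand of the principal ideal `Ann(x)` then `Ann(x) = Ry`. -/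
theorem mul_eq_zero_iff_dvd_of_disjoint {x y a : R} {A B : Ideal R} (hxA : x ∈ A) (hyB : y ∈ B)
    (hd : Disjoint A B) (hy : y ≠ 0) {L : Ideal R} (hyL : Disjoint (Ideal.span {y}) L)
    (hyL' : Ideal.span {y} ⊔ L = B) (hx : Ideal.span {x} = A) (hx0 : x ≠ 0)
    (hAB : A ⊔ B = IsLocalRing.maximalIdeal R) (ha : ∀ r : R, r * x = 0 ↔ a ∣ r) :
    ∀ r : R, r * x = 0 ↔ y ∣ r := by
  subst hx
  have hax : a * x = 0 := (ha a).2 dvd_rfl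
  have ham : a ∈ IsLocalRing.maximalIdeal R := fun hu => hx0 ((hu.mul_right_eq_zero).1 hax)
  rw [← hAB, mem_span_singleton_sup] at ham
  obtain ⟨s, b, hb, hab⟩ := ham
  rw [← hyL', mem_span_singleton_sup] at hb
  obtain ⟨t, l, hl, rfl⟩ := hb
  have hlB : l ∈ B := hyL' ▸ Submodule.mem_sup_right hl
  have hxy : x * y = 0 := mul_eq_zero_of_disjoint hd hxA hyB
  obtain ⟨c, hc⟩ := (ha y).1 (by rw [mul_comm, hxy])
  -- `y = c (s x + t y + l)`; compare components
  obtain ⟨h1, h2⟩ := hd.eq_zero_of_add_eq_zero (a := c * s * x) (b := (c * t - 1) * y + c * l)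
    (Ideal.mul_mem_left _ _ hxA) (B.add_mem (B.mul_mem_left _ hyB) (B.mul_mem_left _ hlB))
    (by linear_combination -hc - c * hab)
  obtain ⟨h3, h4⟩ := hyL.eq_zero_of_add_eq_zero
    (Ideal.mul_mem_left _ _ (Ideal.mem_span_singleton_self y)) (L.mul_mem_left _ hl) h2
  have hu : IsUnit (c * t) := isUnit_of_one_sub_mul_eq_zero hy (by linear_combination -h3)
  have hcu : IsUnit c := isUnit_of_mul_isUnit_left hu
  have hsx : s * x = 0 := (hcu.mul_right_eq_zero).1 (by rw [← mul_assoc, h1])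
  have hl0 : l = 0 := (hcu.mul_right_eq_zero).1 h4
  have hay : y ∣ a := ⟨t, by rw [hab, hsx, hl0]; ring⟩
  intro r
  refine ⟨fun h => hay.trans ((ha r).1 h), ?_⟩
  rintro ⟨k, rfl⟩
  linear_combination k * hxy

/-- A prime ideal containing `y` but not `x`, where `𝔪 = Rx ⊕ Ry`, is equal to `Ry` if it is
a retract of a direct sum of cyclically presented modules. -/
theorem prime_eq_span_singleton {x y : R}
    (hM : Ideal.span {x} ⊔ Ideal.span {y} = IsLocalRing.maximalIdeal R) {P : Ideal R}
    [P.IsPrime] (hyP : y ∈ P) (hxP : x ∉ P) (hP : IsRetractOfCyclicallyPresented R P) :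
    P = Ideal.span {y} := by
  have hxm : x ∈ IsLocalRing.maximalIdeal R :=
    hM ▸ Submodule.mem_sup_left (Ideal.mem_span_singleton_self x)
  -- This says P = xP + Ry. As P is not known to be finitely generated, Nakayama is replaced by
  -- comparing components in a splitting P = Rp ⊕ Q.
  have hdec : ∀ q ∈ P, ∃ s ∈ P, ∃ t, q = s * x + t * y := by
    intro q hq
    have hqM := IsLocalRing.le_maximalIdeal (Ideal.IsPrime.ne_top ‹_›) hq
    rw [← hM, mem_span_singleton_sup_span] at hqM
    obtain ⟨s, t, rfl⟩ := hqM
    have : s * x ∈ P := (P.add_mem_iff_left (P.mul_mem_left t hyP)).1 hq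
    exact ⟨s, (Ideal.IsPrime.mem_or_mem ‹_› this).resolve_right hxP, t, rfl⟩
  by_cases hP0 : P = ⊥
  · subst hP0
    rw [(Ideal.mem_bot).1 hyP, Ideal.span_singleton_zero]
  obtain ⟨p, Q, a, hp, hpQ, hpQ', hQ, -⟩ := hP.exists_span_sup hP0
  have hpP : p ∈ P := hpQ' ▸ Submodule.mem_sup_left (Ideal.mem_span_singleton_self p)
  have hQP : Q ≤ P := hpQ' ▸ le_sup_right
  have hdecP : ∀ q ∈ P, ∃ s, ∃ l ∈ Q, q = s * p + l := fun q hq => by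
    rwa [← hpQ', mem_span_singleton_sup] at hq
  obtain ⟨s, hs, t, hst⟩ := hdec p hpP
  obtain ⟨s₁, s₂, hs₂, rfl⟩ := hdecP s hs
  obtain ⟨y₁, y₂, hy₂, hy⟩ := hdecP y hyP
  have h1 := (hpQ.eq_zero_of_add_eq_zero (a := (s₁ * x + t * y₁ - 1) * p) (b := x * s₂ + t * y₂)
    (Ideal.mul_mem_left _ _ (Ideal.mem_span_singleton_self p))
    (Q.add_mem (Q.mul_mem_left _ hs₂) (Q.mul_mem_left _ hy₂))
    (by linear_combination -hst - t * hy)).1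
  have hu : IsUnit (s₁ * x + t * y₁) := isUnit_of_one_sub_mul_eq_zero hp (by linear_combination -h1)
  have hy₁ : IsUnit y₁ :=
    isUnit_of_mul_isUnit_right (isUnit_of_mem_add (Ideal.mul_mem_left _ s₁ hxm) hu)
  -- Modulo xP everything is a multiple of y, whose p-coefficient `y₁` is a unit. Writing q = zx +
  -- wy, the q-component forces w to be a unit, while the vanishing p-component forces w y₁ into the
  -- maximal ideal.
  have hQ0 : Q = ⊥ := by
    by_contra hQ0
    obtain ⟨q, Q', b, hq, hqQ, hqQ', -, -⟩ := hQ.exists_span_sup hQ0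
    have hqQ₁ : q ∈ Q := hqQ' ▸ Submodule.mem_sup_left (Ideal.mem_span_singleton_self q)
    have hQ'Q : Q' ≤ Q := hqQ' ▸ le_sup_right
    obtain ⟨z, hz, w, hzw⟩ := hdec q (hQP hqQ₁)
    obtain ⟨z₁, z₂, hz₂, rfl⟩ := hdecP z hz
    obtain ⟨h2, h3⟩ := hpQ.eq_zero_of_add_eq_zero (a := (z₁ * x + w * y₁) * p)
      (b := x * z₂ + w * y₂ - q)
      (Ideal.mul_mem_left _ _ (Ideal.mem_span_singleton_self p))
      (Q.sub_mem (Q.add_mem (Q.mul_mem_left _ hz₂) (Q.mul_mem_left _ hy₂)) hqQ₁)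
      (by linear_combination -hzw - w * hy)
    rw [← hqQ', mem_span_singleton_sup] at hz₂ hy₂
    obtain ⟨z₃, z₄, hz₄, rfl⟩ := hz₂
    obtain ⟨y₃, y₄, hy₄, rfl⟩ := hy₂
    have h4 := (hqQ.eq_zero_of_add_eq_zero (a := (z₃ * x + w * y₃ - 1) * q)
      (b := x * z₄ + w * y₄)
      (Ideal.mul_mem_left _ _ (Ideal.mem_span_singleton_self q))
      (Q'.add_mem (Q'.mul_mem_left _ hz₄) (Q'.mul_mem_left _ hy₄))
      (by linear_combination h3)).1
    have hu' : IsUnit (z₃ * x + w * y₃) :=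
      isUnit_of_one_sub_mul_eq_zero hq (by linear_combination -h4)
    have hw : IsUnit w :=
      isUnit_of_mul_isUnit_left (isUnit_of_mem_add (Ideal.mul_mem_left _ z₃ hxm) hu')
    have hu'' : ¬ IsUnit (z₁ * x + w * y₁) := fun h => hp ((h.mul_right_eq_zero).1 h2)
    refine hu'' ?_
    by_contra hn
    have : w * y₁ ∈ IsLocalRing.maximalIdeal R :=
      ((IsLocalRing.maximalIdeal R).add_mem_iff_right (Ideal.mul_mem_left _ z₁ hxm)).1 hn
    exact this (hw.mul hy₁)
  subst hQ0
  rw [(Submodule.mem_bot R).1 hy₂, add_zero] at hy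
  rw [← hpQ', sup_bot_eq, hy, mul_comm, Ideal.span_singleton_mul_right_unit hy₁]

/-- It suffices that primes be principal. A prime over y either contains x, hence is maximal with
image generated by x, or is Ry with image zero. -/
theorem isPrincipalIdealRing_quotient {x y : R}
    (hM : Ideal.span {x} ⊔ Ideal.span {y} = IsLocalRing.maximalIdeal R)
    (h : ∀ P : Ideal R, P.IsPrime → IsRetractOfCyclicallyPresented R P) :
    IsPrincipalIdealRing (R ⧸ Ideal.span {y}) := by
  refine IsPrincipalIdealRing.of_prime fun P' hP' => ?_
  have hsurj := Ideal.Quotient.mk_surjective (I := Ideal.span {y})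
  have hy0 : Ideal.Quotient.mk (Ideal.span {y}) y = 0 :=
    Ideal.Quotient.eq_zero_iff_mem.2 (Ideal.mem_span_singleton_self y)
  rw [← Ideal.map_comap_of_surjective _ hsurj P']
  set P := P'.comap (Ideal.Quotient.mk (Ideal.span {y})) with hPdef
  have hP : P.IsPrime := Ideal.comap_isPrime _ _
  have hyP : y ∈ P := by
    rw [hPdef, Ideal.mem_comap, hy0]; exact zero_mem _
  by_cases hxP : x ∈ P
  · have : P = Ideal.span {x} ⊔ Ideal.span {y} := by
      refine le_antisymm (hM ▸ IsLocalRing.le_maximalIdeal hP.ne_top) ?_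
      rw [sup_le_iff, Ideal.span_singleton_le_iff_mem, Ideal.span_singleton_le_iff_mem]
      exact ⟨hxP, hyP⟩
    rw [this, Ideal.map_sup, Ideal.map_span, Ideal.map_span, Set.image_singleton,
      Set.image_singleton, hy0, Ideal.span_singleton_zero, sup_bot_eq]
    exact ⟨_, rfl⟩
  · rw [prime_eq_span_singleton hM hyP hxP (h P hP), Ideal.map_span, Set.image_singleton]
    exact ⟨_, rfl⟩

theorem isPrincipalIdealRing_or_exists_decomposition
    (h : ∀ P : Ideal R, P.IsPrime → IsRetractOfCyclicallyPresented R P) :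
    IsPrincipalIdealRing R ∨ ∃ x : Fin 2 → R,
      IsCyclicDecomposition (IsLocalRing.maximalIdeal R) x ∧
        ∀ i, IsPrincipalIdealRing (R ⧸ Ideal.torsionOf R R (x i)) := by
  have hmax := h (IsLocalRing.maximalIdeal R) inferInstance
  by_cases hM0 : IsLocalRing.maximalIdeal R = ⊥
  · refine Or.inl (IsPrincipalIdealRing.of_prime fun P hP => ?_)
    have : P = ⊥ := le_bot_iff.1 (hM0 ▸ IsLocalRing.le_maximalIdeal hP.ne_top)
    rw [this]
    infer_instance
  obtain ⟨x, L, a, hx, hxL, hxL', hL, ha⟩ := hmax.exists_span_sup hM0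
  by_cases hL0 : L = ⊥
  · refine Or.inl (IsPrincipalIdealRing.of_prime fun P hP => ?_)
    subst hL0
    by_cases hxP : x ∈ P
    · have : P = Ideal.span {x} := le_antisymm
        (by rw [sup_bot_eq] at hxL'; exact hxL' ▸ IsLocalRing.le_maximalIdeal hP.ne_top)
        ((Ideal.span_singleton_le_iff_mem _).2 hxP)
      exact ⟨x, this⟩
    · have := prime_eq_span_singleton (x := x) (y := 0)
        (by rwa [Ideal.span_singleton_zero]) P.zero_mem hxP (h P hP)
      exact ⟨0, this⟩
  · obtain ⟨y, L', b, hy, hyL, hyL', hL', hb⟩ := hL.exists_span_sup hL0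
    have hyinL : y ∈ L := hyL' ▸ Submodule.mem_sup_left (Ideal.mem_span_singleton_self y)
    have hxmem := Ideal.mem_span_singleton_self x
    have hannx := mul_eq_zero_iff_dvd_of_disjoint hxmem hyinL hxL hy hyL hyL' rfl hx hxL' ha
    -- L annihilates x and Ann(x) = Ry, so no third summand survives.
    have hLy : L = Ideal.span {y} := by
      refine le_antisymm (fun l hl => ?_) ((Ideal.span_singleton_le_iff_mem _).2 hyinL)
      rw [Ideal.mem_span_singleton, ← hannx, mul_comm]
      exact mul_eq_zero_of_disjoint hxL hxmem hl
    subst hLy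
    have hanny := mul_eq_zero_iff_dvd_of_disjoint hyinL hxmem hxL.symm hx disjoint_bot_right
      (sup_bot_eq _) rfl hy (by rw [sup_comm, hxL']) hb
    refine Or.inr ⟨![x, y], isCyclicDecomposition_pair hx hy hxL hxL', fun i => ?_⟩
    fin_cases i
    · change IsPrincipalIdealRing (R ⧸ Ideal.torsionOf R R x)
      rw [torsionOf_eq_span hannx]
      exact isPrincipalIdealRing_quotient hxL' h
    · change IsPrincipalIdealRing (R ⧸ Ideal.torsionOf R R y)
      rw [torsionOf_eq_span hanny]
      exact isPrincipalIdealRing_quotient (by rw [sup_comm, hxL']) h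

end Local

/-! ### Classification of ideals when the maximal ideal is Rx ⊕ Ry -/

section Converse

variable {R : Type u} [CommRing R]

theorem isDirectSumOfCyclicallyPresented_sup {z w a b : R}
    (hd : Disjoint (Ideal.span {z}) (Ideal.span {w}))
    (hz : ∀ r : R, r * z = 0 ↔ a ∣ r) (hw : ∀ r : R, r * w = 0 ↔ b ∣ r) :
    IsDirectSumOfCyclicallyPresented R (Ideal.span {z} ⊔ Ideal.span {w} : Ideal R) := by
  classical
  -- The lift puts the two-element index set in the universe of R.
  let c : ULift.{u} Bool → R := fun i => if i.down then a else b
  let v : ULift.{u} Bool → R := fun i => if i.down then z else w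
  have hc : ∀ i, ∀ r : R, r * v i = 0 ↔ c i ∣ r := by
    rintro ⟨_ | _⟩
    · exact hw
    · exact hz
  obtain ⟨g, hg⟩ : ∃ g : ∀ i, (R ⧸ Ideal.span {c i}) →ₗ[R] R,
      ∀ i r, g i (Submodule.Quotient.mk r) = r * v i := by
    have hle : ∀ i, Ideal.span {c i} ≤ LinearMap.ker (LinearMap.toSpanSingleton R R (v i)) :=
      fun i r hr => (hc i r).2 (Ideal.mem_span_singleton.1 hr)
    exact ⟨fun i => Submodule.liftQ _ _ (hle i), fun i r => rfl⟩
  let e : (⨁ i, R ⧸ Ideal.span {c i}) ≃ₗ[R] ∀ i, R ⧸ Ideal.span {c i} :=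
    DirectSum.linearEquivFunOnFintype R (ULift.{u} Bool) _
  let π : ∀ i, (∀ i, R ⧸ Ideal.span {c i}) →ₗ[R] R ⧸ Ideal.span {c i} := LinearMap.proj
  let F : (∀ i, R ⧸ Ideal.span {c i}) →ₗ[R] R :=
    (g ⟨true⟩).comp (π ⟨true⟩) + (g ⟨false⟩).comp (π ⟨false⟩)
  have hker : LinearMap.ker F = ⊥ := by
    rw [LinearMap.ker_eq_bot']
    intro m hm
    obtain ⟨r, hr⟩ := Submodule.Quotient.mk_surjective _ (m ⟨true⟩)
    obtain ⟨s, hs⟩ := Submodule.Quotient.mk_surjective _ (m ⟨false⟩)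
    have hm' : r * z + s * w = 0 := by
      have : g ⟨true⟩ (m ⟨true⟩) + g ⟨false⟩ (m ⟨false⟩) = 0 := hm
      rw [← hr, ← hs, hg, hg] at this
      exact this
    obtain ⟨h1, h2⟩ := hd.eq_zero_of_add_eq_zero
      (Ideal.mul_mem_left _ r (Ideal.mem_span_singleton_self z))
      (Ideal.mul_mem_left _ s (Ideal.mem_span_singleton_self w)) hm'
    funext i
    rcases i with ⟨_ | _⟩
    · rw [← hs]
      exact (Submodule.Quotient.mk_eq_zero _).2 (Ideal.mem_span_singleton.2 ((hw s).1 h2))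
    · rw [← hr]
      exact (Submodule.Quotient.mk_eq_zero _).2 (Ideal.mem_span_singleton.2 ((hz r).1 h1))
  have hrange : LinearMap.range F = Ideal.span {z} ⊔ Ideal.span {w} := by
    ext q
    rw [mem_span_singleton_sup_span]
    constructor
    · rintro ⟨m, rfl⟩
      obtain ⟨r, hr⟩ := Submodule.Quotient.mk_surjective _ (m ⟨true⟩)
      obtain ⟨s, hs⟩ := Submodule.Quotient.mk_surjective _ (m ⟨false⟩)
      refine ⟨r, s, ?_⟩
      change g ⟨true⟩ (m ⟨true⟩) + g ⟨false⟩ (m ⟨false⟩) = _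
      rw [← hr, ← hs, hg, hg]
      rfl
    · rintro ⟨r, s, rfl⟩
      refine ⟨fun i => Submodule.Quotient.mk (if i.down then r else s), ?_⟩
      change g ⟨true⟩ (Submodule.Quotient.mk r) + g ⟨false⟩ (Submodule.Quotient.mk s) = _
      rw [hg, hg]
      rfl
  exact ⟨ULift.{u} Bool, c, ⟨(e.trans
    ((LinearEquiv.ofInjective F (LinearMap.ker_eq_bot.1 hker)).trans
      (LinearEquiv.ofEq _ _ hrange))).symm⟩⟩

theorem isDirectSumOfCyclicallyPresented_span {z a : R} (hz : ∀ r : R, r * z = 0 ↔ a ∣ r) :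
    IsDirectSumOfCyclicallyPresented R (Ideal.span {z} : Ideal R) := by
  -- The second summand is zero, presented as R/R.
  have := isDirectSumOfCyclicallyPresented_sup (z := z) (w := 0) (b := 1)
    (by rw [Ideal.span_singleton_zero]; exact disjoint_bot_right) hz (by simp)
  rwa [Ideal.span_singleton_zero, sup_bot_eq] at this

theorem isDirectSumOfCyclicallyPresented_of_isPrincipalIdealRing [IsPrincipalIdealRing R]
    (I : Ideal R) : IsDirectSumOfCyclicallyPresented R I := by
  obtain ⟨z, hz⟩ := IsPrincipalIdealRing.principal I
  obtain ⟨a, ha⟩ := IsPrincipalIdealRing.principal (Ideal.torsionOf R R z)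
  obtain rfl : I = Ideal.span {z} := hz
  refine isDirectSumOfCyclicallyPresented_span (a := a) fun r => ?_
  rw [← smul_eq_mul, ← Ideal.mem_torsionOf_iff, ha]
  exact Ideal.mem_span_singleton

/-- Every nonzero element of `Rx` is a unit times a positive power of `x`. -/
def HasUnitPowForm (x : R) : Prop :=
  ∀ z ∈ Ideal.span {x}, z ≠ 0 → ∃ (a : R) (n : ℕ), IsUnit a ∧ 0 < n ∧ z = a * x ^ n

theorem HasUnitPowForm.eq_bot_or_eq_span_pow {x : R} (hx : HasUnitPowForm x) {I : Ideal R}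
    (hI : I ≤ Ideal.span {x}) : I = ⊥ ∨ ∃ n, 0 < n ∧ I = Ideal.span {x ^ n} := by
  classical
  by_cases hP : ∃ n, 0 < n ∧ x ^ n ∈ I
  · obtain ⟨hn, hmem⟩ := Nat.find_spec hP
    refine Or.inr ⟨Nat.find hP, hn, le_antisymm (fun z hz => ?_)
      ((Ideal.span_singleton_le_iff_mem _).2 hmem)⟩
    by_cases hz0 : z = 0
    · rw [hz0]; exact zero_mem _
    obtain ⟨a, k, ha, hk, rfl⟩ := hx z (hI hz) hz0
    have := Nat.find_min' hP ⟨hk, (Ideal.unit_mul_mem_iff_mem I ha).1 hz⟩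
    exact Ideal.mem_span_singleton.2 ((pow_dvd_pow x this).mul_left a)
  · refine Or.inl (le_bot_iff.1 fun z hz => ?_)
    by_contra hz0
    obtain ⟨a, k, ha, hk, rfl⟩ := hx z (hI hz) hz0
    exact hP ⟨k, hk, (Ideal.unit_mul_mem_iff_mem I ha).1 hz⟩

/-- If `n` is least such that some `x ^ n + w`, `w ∈ Ry`, lies in `I`, then the
`x`-components of elements of `I` lie in `Rx ^ n`. -/
theorem mem_span_pow_of_add_mem {x y : R} (hx : HasUnitPowForm x) {I : Ideal R} {n : ℕ}
    (hmin : ∀ k, 0 < k → ∀ w ∈ Ideal.span {y}, x ^ k + w ∈ I → n ≤ k) {v w : R}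
    (hv : v ∈ Ideal.span {x}) (hw : w ∈ Ideal.span {y}) (h : v + w ∈ I) :
    v ∈ Ideal.span {x ^ n} := by
  by_cases hv0 : v = 0
  · rw [hv0]; exact zero_mem _
  obtain ⟨a, k, ⟨a, rfl⟩, hk, rfl⟩ := hx v hv hv0
  have hmem := I.mul_mem_left (a⁻¹ : Rˣ) h
  rw [mul_add, Units.inv_mul_cancel_left] at hmem
  have := hmin k hk _ (Ideal.mul_mem_left _ _ hw) hmem
  exact Ideal.mem_span_singleton.2 ((pow_dvd_pow x this).mul_left _)

variable [IsLocalRing R]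

/-- An r killing x^n ≠ 0 is a nonunit, so r = sx + ty. If sx were nonzero it would be a unit times
x^k, giving x^(k+n) = 0 against non-nilpotency. -/
theorem mul_pow_eq_zero_iff {x y : R} (hxy : x * y = 0) (hx : HasUnitPowForm x)
    (hnil : ¬ IsNilpotent x)
    (hM : Ideal.span {x} ⊔ Ideal.span {y} = IsLocalRing.maximalIdeal R) {n : ℕ} (hn : 0 < n)
    (r : R) : r * x ^ n = 0 ↔ y ∣ r := by
  constructor
  · intro hr
    have hrm : r ∈ IsLocalRing.maximalIdeal R := fun hu =>
      hnil ⟨n, (hu.mul_right_eq_zero).1 hr⟩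
    rw [← hM, mem_span_singleton_sup_span] at hrm
    obtain ⟨s, t, rfl⟩ := hrm
    by_cases hs : s * x = 0
    · exact ⟨t, by rw [hs]; ring⟩
    exfalso
    obtain ⟨a, k, ha, hk, hak⟩ := hx _ (Ideal.mul_mem_left _ s (Ideal.mem_span_singleton_self x)) hs
    obtain ⟨n, rfl⟩ : ∃ m, n = m + 1 := ⟨n - 1, by omega⟩
    refine hnil ⟨k + (n + 1), (ha.mul_right_eq_zero).1 ?_⟩
    rw [pow_add]
    linear_combination hr - x ^ (n + 1) * hak - t * x ^ n * hxy
  · rintro ⟨c, rfl⟩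
    obtain ⟨n, rfl⟩ : ∃ m, n = m + 1 := ⟨n - 1, by omega⟩
    rw [pow_succ]
    linear_combination c * x ^ n * hxy

/-- Take the least exponents n and m occurring in the x- and y-components of elements of I. Then
Rx^n ⊕ Ry^m contains I, and the cases are whether I contains x^n itself. -/
theorem isDirectSumOfCyclicallyPresented_of_decomposition {x y : R}
    (hd : Disjoint (Ideal.span {x}) (Ideal.span {y}))
    (hM : Ideal.span {x} ⊔ Ideal.span {y} = IsLocalRing.maximalIdeal R)
    (hx : HasUnitPowForm x) (hy : HasUnitPowForm y)
    (hxnil : ¬ IsNilpotent x) (hynil : ¬ IsNilpotent y) (I : Ideal R) :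
    IsDirectSumOfCyclicallyPresented R I := by
  classical
  have hxx := Ideal.mem_span_singleton_self x
  have hyy := Ideal.mem_span_singleton_self y
  have hxy : x * y = 0 := mul_eq_zero_of_disjoint hd hxx hyy
  have hannx := fun {n : ℕ} (hn : 0 < n) => mul_pow_eq_zero_iff hxy hx hxnil hM hn
  have hanny := fun {n : ℕ} (hn : 0 < n) =>
    mul_pow_eq_zero_iff (mul_comm x y ▸ hxy) hy hynil (by rw [sup_comm, hM]) hn
  have hbot : IsDirectSumOfCyclicallyPresented R (⊥ : Ideal R) := by
    rw [← Ideal.span_singleton_zero]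
    exact isDirectSumOfCyclicallyPresented_span (a := 1) (by simp)
  have hxy_mem : ∀ {n m : ℕ}, 0 < n → 0 < m →
      Disjoint (Ideal.span {x ^ n}) (Ideal.span {y ^ m}) := fun hn hm =>
    hd.mono (Ideal.span_singleton_le_span_singleton.2 (dvd_pow_self x hn.ne'))
      (Ideal.span_singleton_le_span_singleton.2 (dvd_pow_self y hm.ne'))
  by_cases hI : I = ⊤
  · rw [hI, ← Ideal.span_singleton_one]
    exact isDirectSumOfCyclicallyPresented_span (a := 0) (by simp)
  have hdec : ∀ q ∈ I, ∃ v ∈ Ideal.span {x}, ∃ w ∈ Ideal.span {y}, v + w = q := fun q hq => by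
    have := IsLocalRing.le_maximalIdeal hI hq
    rw [← hM] at this
    exact Submodule.mem_sup.1 this
  by_cases hPX : ∃ n, 0 < n ∧ ∃ w ∈ Ideal.span {y}, x ^ n + w ∈ I
  swap
  -- A nonzero x-component, rescaled by a unit, would be a power of x.
  · have hle : I ≤ Ideal.span {y} := by
      intro q hq
      obtain ⟨v, hv, w, hw, rfl⟩ := hdec q hq
      by_cases hv0 : v = 0
      · rwa [hv0, zero_add]
      obtain ⟨a, k, ⟨a, rfl⟩, hk, rfl⟩ := hx v hv hv0
      have hmem := I.mul_mem_left (a⁻¹ : Rˣ) hq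
      rw [mul_add, Units.inv_mul_cancel_left] at hmem
      exact absurd ⟨k, hk, _, Ideal.mul_mem_left _ _ hw, hmem⟩ hPX
    rcases hy.eq_bot_or_eq_span_pow hle with rfl | ⟨n, hn, rfl⟩
    · exact hbot
    · exact isDirectSumOfCyclicallyPresented_span (hanny hn)
  by_cases hPY : ∃ n, 0 < n ∧ ∃ w ∈ Ideal.span {x}, y ^ n + w ∈ I
  swap
  · have hle : I ≤ Ideal.span {x} := by
      intro q hq
      obtain ⟨v, hv, w, hw, rfl⟩ := hdec q hq
      by_cases hw0 : w = 0
      · rwa [hw0, add_zero]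
      obtain ⟨a, k, ⟨a, rfl⟩, hk, rfl⟩ := hy w hw hw0
      have hmem := I.mul_mem_left (a⁻¹ : Rˣ) hq
      rw [mul_add, Units.inv_mul_cancel_left, add_comm] at hmem
      exact absurd ⟨k, hk, _, Ideal.mul_mem_left _ _ hv, hmem⟩ hPY
    rcases hx.eq_bot_or_eq_span_pow hle with rfl | ⟨n, hn, rfl⟩
    · exact hbot
    · exact isDirectSumOfCyclicallyPresented_span (hannx hn)
  obtain ⟨hn, w, hw, hzI⟩ := Nat.find_spec hPX
  obtain ⟨hm, v, hv, hz'I⟩ := Nat.find_spec hPY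
  have hminX : ∀ k, 0 < k → ∀ w ∈ Ideal.span {y}, x ^ k + w ∈ I → Nat.find hPX ≤ k :=
    fun k hk w hw h => Nat.find_min' hPX ⟨hk, w, hw, h⟩
  have hminY : ∀ k, 0 < k → ∀ w ∈ Ideal.span {x}, y ^ k + w ∈ I → Nat.find hPY ≤ k :=
    fun k hk w hw h => Nat.find_min' hPY ⟨hk, w, hw, h⟩
  generalize Nat.find hPX = n at hn hzI hminX
  generalize Nat.find hPY = m at hm hz'I hminY
  have hxn : x ^ n ∈ Ideal.span {x} := Ideal.pow_mem_of_mem _ hxx n hn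
  have hym : y ^ m ∈ Ideal.span {y} := Ideal.pow_mem_of_mem _ hyy m hm
  have hcomp : ∀ v ∈ Ideal.span {x}, ∀ w ∈ Ideal.span {y}, v + w ∈ I →
      v ∈ Ideal.span {x ^ n} ∧ w ∈ Ideal.span {y ^ m} := fun v hv w hw h =>
    ⟨mem_span_pow_of_add_mem hx hminX hv hw h,
      mem_span_pow_of_add_mem hy hminY hw hv (by rwa [add_comm])⟩
  have hyx : y ^ m ∈ I → x ^ n ∈ I := fun h => by
    have := (Ideal.span_singleton_le_iff_mem I).2 h (hcomp _ hxn _ hw hzI).2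
    exact (I.add_mem_iff_left this).1 hzI
  by_cases hxI : x ^ n ∈ I
  · have hyI : y ^ m ∈ I := by
      have := (Ideal.span_singleton_le_iff_mem I).2 hxI
        (hcomp _ hv _ hym (by rwa [add_comm])).1
      exact (I.add_mem_iff_left this).1 hz'I
    have : I = Ideal.span {x ^ n} ⊔ Ideal.span {y ^ m} := by
      refine le_antisymm (fun q hq => ?_) (sup_le ((Ideal.span_singleton_le_iff_mem I).2 hxI)
        ((Ideal.span_singleton_le_iff_mem I).2 hyI))
      obtain ⟨v, hv, w, hw, rfl⟩ := hdec q hq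
      exact Submodule.add_mem_sup (hcomp v hv w hw hq).1 (hcomp v hv w hw hq).2
    rw [this]
    exact isDirectSumOfCyclicallyPresented_sup (hxy_mem hn hm) (hannx hn) (hanny hm)
  -- the generator is `x ^ n + u * y ^ m` with `u` a unit
  have hyI : y ^ m ∉ I := fun h => hxI (hyx h)
  have hy1 : y ^ (m + 1) ∈ I := by
    have h1 := I.mul_mem_left y hz'I
    have h2 : y * v = 0 := mul_eq_zero_of_disjoint hd.symm hyy hv
    rwa [mul_add, h2, add_zero, ← pow_succ'] at h1
  obtain ⟨u, rfl⟩ := Ideal.mem_span_singleton'.1 (hcomp _ hxn _ hw hzI).2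
  -- Since y^m is not in I, such a c is a nonunit; its x-part kills y^m.
  have hmemunit : ∀ c : R, c * y ^ m ∈ I → ∃ d, c * y ^ m = d * y ^ (m + 1) := by
    intro c hc
    have hcm : c ∈ Ideal.span {x} ⊔ Ideal.span {y} := by
      rw [hM]
      exact fun hu => hyI ((Ideal.unit_mul_mem_iff_mem I hu).1 hc)
    rw [mem_span_singleton_sup_span] at hcm
    obtain ⟨s, t, rfl⟩ := hcm
    have : x * y ^ m = 0 := mul_eq_zero_of_disjoint hd hxx hym
    exact ⟨t, by rw [pow_succ]; linear_combination s * this⟩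
  have hu : IsUnit u := by
    by_contra hu
    have hum : u ∈ Ideal.span {x} ⊔ Ideal.span {y} := hM ▸ hu
    rw [mem_span_singleton_sup_span] at hum
    obtain ⟨s, t, rfl⟩ := hum
    have h0 : x * y ^ m = 0 := mul_eq_zero_of_disjoint hd hxx hym
    have : (s * x + t * y) * y ^ m = t * y ^ (m + 1) := by
      rw [pow_succ]; linear_combination s * h0
    rw [this] at hzI
    exact hxI ((I.add_mem_iff_left (I.mul_mem_left t hy1)).1 hzI)
  have hyxn : y * x ^ n = 0 := mul_eq_zero_of_disjoint hd.symm hyy hxn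
  have hIz : I = Ideal.span {x ^ n + u * y ^ m} := by
    refine le_antisymm (fun q hq => ?_) ((Ideal.span_singleton_le_iff_mem I).2 hzI)
    obtain ⟨v, hv, w, hw, rfl⟩ := hdec q hq
    obtain ⟨h1, h2⟩ := hcomp v hv w hw hq
    obtain ⟨α, rfl⟩ := Ideal.mem_span_singleton'.1 h1
    obtain ⟨β, rfl⟩ := Ideal.mem_span_singleton'.1 h2
    have h3 : (β - α * u) * y ^ m ∈ I := by
      have := I.sub_mem hq (I.mul_mem_left α hzI)
      convert this using 1
      ring
    obtain ⟨d, hd'⟩ := hmemunit _ h3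
    obtain ⟨u, rfl⟩ := hu
    -- α matches the x-component. The y-component is then off by (β - αu) y^m = d y^(m+1), which d
    -- u⁻¹ y times the generator supplies because y x^n = 0.
    refine Ideal.mem_span_singleton'.2 ⟨α + d * (u⁻¹ : Rˣ) * y, ?_⟩
    have hinv : ((u⁻¹ : Rˣ) : R) * u = 1 := Units.inv_mul u
    rw [pow_succ] at hd'
    linear_combination d * (u⁻¹ : Rˣ) * hyxn + d * y * y ^ m * hinv - hd'
  rw [hIz]
  -- I is free of rank one: an annihilator of the generator kills x^n and y^m, hence lies in Ry ∩ Rx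
  -- = 0.
  refine isDirectSumOfCyclicallyPresented_span (a := 0) fun r => ?_
  rw [zero_dvd_iff]
  refine ⟨fun hr => ?_, fun hr => by rw [hr, zero_mul]⟩
  obtain ⟨h1, h2⟩ := hd.eq_zero_of_add_eq_zero (a := r * x ^ n) (b := r * u * y ^ m)
    (Ideal.mul_mem_left _ _ hxn) (Ideal.mul_mem_left _ _ hym) (by linear_combination hr)
  have h3 : r * y ^ m = 0 := (hu.mul_right_eq_zero).1 (by linear_combination h2)
  exact Submodule.disjoint_def.1 hd r (Ideal.mem_span_singleton.2 ((hanny hm r).1 h3))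
    (Ideal.mem_span_singleton.2 ((hannx hn r).1 h1))

end Converse

/-! ### Reduction to the local case and the equivalence -/

theorem ConditionStar.isLocalRing {R : Type u} [CommRing R] [Nontrivial R]
    (h : ConditionStar R) : IsLocalRing R := by
  obtain ⟨M, hM⟩ := Ideal.exists_maximal R
  refine IsLocalRing.of_unique_max_ideal ⟨M, hM, fun M' hM' => ?_⟩
  by_contra hne
  have hsup : M' ⊔ M = ⊤ := hM'.coprime_of_ne hM hne
  -- Comaximality gives M'(R/M) = R/M, so the Nakayama clause would make R/M vanish.
  have hsub : Subsingleton (R ⧸ M) := by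
    refine h.nakayama (R ⧸ M) inferInstance M' hM' M' le_rfl ?_
    refine eq_top_iff.2 fun z _ => ?_
    obtain ⟨m', hm', m, hm, hmm⟩ := Submodule.mem_sup.1 (hsup ▸ Submodule.mem_top : (1 : R) ∈ M' ⊔ M)
    obtain ⟨r, rfl⟩ := Ideal.Quotient.mk_surjective z
    have : Ideal.Quotient.mk M r = m' • Ideal.Quotient.mk M r := by
      change _ = Ideal.Quotient.mk M (m' * r)
      rw [Ideal.Quotient.eq]
      convert M.mul_mem_right r hm using 1
      linear_combination -r * hmm
    rw [this]
    exact Submodule.smul_mem_smul hm' trivial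
  exact hM.ne_top (Ideal.Quotient.subsingleton_iff.1 hsub)

theorem mainTheorem1 (R : Type u) [CommRing R]
    (hsemilocal : Finite (MaximalSpectrum R))
    (hstar : ConditionStar R)
    (hnil : ∀ (M : Ideal R), M.IsMaximal → ∀ (ι : Type u) (x : ι → R),
      IsCyclicDecomposition M x → ∀ i, ¬ IsNilpotent (x i)) :
    List.TFAE [
      ∀ I : Ideal R, IsDirectSumOfCyclicallyPresented R I,
      ∀ I : Ideal R, IsSummandOfDirectSumOfCyclicallyPresented R I,
      ∀ P : Ideal R, P.IsPrime → IsDirectSumOfCyclicallyPresented R P,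
      ∀ P : Ideal R, P.IsPrime → IsSummandOfDirectSumOfCyclicallyPresented R P,
      IsPrincipalIdealRing R ∨
        ∀ M : Ideal R, M.IsMaximal → ∃ x : Fin 2 → R, IsCyclicDecomposition M x ∧
          ∀ i, IsPrincipalIdealRing (R ⧸ Ideal.torsionOf R R (x i))] := by
  tfae_have 1 → 2 := fun h I => (h I).isSummand
  tfae_have 1 → 3 := fun h P _ => h P
  tfae_have 2 → 4 := fun h P _ => h P
  tfae_have 3 → 4 := fun h P hP => (h P hP).isSummand
  tfae_have 4 → 5 := by
    intro h
    cases subsingleton_or_nontrivial R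
    · exact Or.inl ⟨fun I => ⟨0, Subsingleton.elim _ _⟩⟩
    have := hstar.isLocalRing
    refine (isPrincipalIdealRing_or_exists_decomposition fun P hP => (h P hP).isRetract).imp_right
      fun h M hM => ?_
    rwa [IsLocalRing.eq_maximalIdeal hM]
  tfae_have 5 → 1 := by
    rintro (h | h) I
    · exact isDirectSumOfCyclicallyPresented_of_isPrincipalIdealRing I
    cases subsingleton_or_nontrivial R
    · have : IsPrincipalIdealRing R := ⟨fun I => ⟨0, Subsingleton.elim _ _⟩⟩
      exact isDirectSumOfCyclicallyPresented_of_isPrincipalIdealRing I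
    have := hstar.isLocalRing
    have hmax := IsLocalRing.maximalIdeal.isMaximal R
    obtain ⟨x, hx, hpir⟩ := h _ hmax
    have hd : Disjoint (Ideal.span {x 0}) (Ideal.span {x 1}) :=
      hx.indep.pairwiseDisjoint (by decide : (0 : Fin 2) ≠ 1)
    have hM : Ideal.span {x 0} ⊔ Ideal.span {x 1} = IsLocalRing.maximalIdeal R := by
      rw [← hx.iSup_eq]
      refine le_antisymm (sup_le (le_iSup (fun i => Ideal.span {x i}) 0)
        (le_iSup (fun i => Ideal.span {x i}) 1)) (iSup_le fun i => ?_)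
      fin_cases i
      · exact le_sup_left
      · exact le_sup_right
    have hnil' : ∀ i, ¬ IsNilpotent (x i) := fun i =>
      -- The non-nilpotency hypothesis ranges over index types in universe u, so the pair is
      -- reindexed.
      hnil _ hmax (ULift (Fin 2)) (x ∘ ULift.down)
        ⟨fun i => hx.ne_zero _, hx.indep.comp ULift.down_injective, by
          rw [← hx.iSup_eq]
          exact Equiv.ulift.iSup_comp (g := fun i => Ideal.span {x i})⟩ ⟨i⟩
    exact isDirectSumOfCyclicallyPresented_of_decomposition hd hM
      (hstar.unit_mul_pow _ hmax _ _ hd hM (hpir 0))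
      (hstar.unit_mul_pow _ hmax _ _ hd.symm (by rw [sup_comm, hM]) (hpir 1))
      (hnil' 0) (hnil' 1) I
  tfae_finish
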